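/- Let $M=(M(v,w))_{v,w\in V}$ be a nonnegative real matrix indexed by an infinite set $V$. Its digraph has vertex set $V$ and an arc $(v,w)$ whenever $M(v,w)\ne 0$ (loops are allowed and count as directed cycles of length one). Assume that $M$ is irreducible, i.e. that its digraph is strongly connected. For $n\in\mathbb N$ let $\lambda_n(M)$ be the supremum of the spectral radii of the $n\times n$ principal submatrices of $M$, and let $\lambda(M)=\lim_{n\to\infty}\lambda_n(M)$, which is the supremum of the spectral radii of all finite principal submatrices of $M$; assume that $\lambda(M)<\infty$. The matrix $M$ is called transient if the series $\sum_{p=0}^{\infty}M^{p}\lambda(M)^{-p}$ converges entrywise, and recurrent otherwise. Corollary 3. Suppose that the digraph of $M$ admits a finite cycle transversal, i.e. a finite set of vertices whose removal (together with all incident arcs) leaves a digraph with no directed cycles, and that $\lambda(M)-\lambda_n(M)=o(1/n)$ as $n\to\infty$. Then $M$ is recurrent. -/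

import Mathlib

open Filter Asymptotics
open scoped ENNReal

/-- A directed cycle of length `k + 1` in a digraph (a loop if `k = 0`): a cyclically ordered list
of pairwise distinct vertices such that each one is joined by an arc to the next one. Addition in
`Fin (k + 1)` is modulo `k + 1`. -/
def Digraph.IsDirectedCycle {V : Type*} (D : Digraph V) {k : ℕ} (c : Fin (k + 1) → V) : Prop :=
  Function.Injective c ∧ ∀ i, D.Adj (c i) (c (i + 1))

/-- The digraph obtained by removing the vertices of `W` with all their incident arcs. -/
def Digraph.deleteVertices {V : Type*} (D : Digraph V) (W : Set V) :
    Digraph {v : V // v ∉ W} where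
  Adj v w := D.Adj v.1 w.1

/-- `W` is a cycle transversal of `D` if the digraph without `W` has no directed cycles. -/
def Digraph.IsCycleTransversal {V : Type*} (D : Digraph V) (W : Set V) : Prop :=
  ∀ (k : ℕ) (c : Fin (k + 1) → {v : V // v ∉ W}), ¬ (D.deleteVertices W).IsDirectedCycle c

namespace Matrix

variable {V : Type*}

/-- The digraph of a square matrix: `(v, w)` is an arc iff the `(v, w)` entry is non-zero. -/
def toDigraph (M : Matrix V V ℝ) : Digraph V where
  Adj v w := M v w ≠ 0

open Classical in
/-- The spectral radius (largest modulus of a complex eigenvalue) of the finite principal submatrix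
of `M` with index set `F`. -/
noncomputable def principalRadius (M : Matrix V V ℝ) (F : Finset V) : ℝ≥0∞ :=
  spectralRadius ℂ
    ((M.submatrix ((↑) : F → V) ((↑) : F → V)).map ((↑) : ℝ → ℂ))

/-- `λ_n(M)`: the supremum of the spectral radii of the principal submatrices of order `n`. -/
noncomputable def truncatedRadius (M : Matrix V V ℝ) (n : ℕ) : ℝ≥0∞ :=
  ⨆ (F : Finset V) (_ : F.card = n), M.principalRadius F

/-- `λ(M)`, the intrinsic spectral radius: the supremum of the spectral radii of all finite
principal submatrices. -/
noncomputable def intrinsicRadius (M : Matrix V V ℝ) : ℝ≥0∞ :=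
  ⨆ F : Finset V, M.principalRadius F

open Classical in
/-- The entries of the `p`-th power of a (possibly infinite) entrywise nonnegative matrix, as
sums of nonnegative terms with values in `[0, ∞]`. -/
noncomputable def powEntry (M : Matrix V V ℝ) : ℕ → V → V → ℝ≥0∞
  | 0, v, w => if v = w then 1 else 0
  | p + 1, v, w => ∑' u, powEntry M p v u * ENNReal.ofReal (M u w)

/-- `M` is transient if the series `∑ M ^ p * z ^ (-p)` of nonnegative terms converges
entrywise at `z = λ(M)`. -/
def IsTransient (M : Matrix V V ℝ) : Prop :=
  ∀ v w : V, ∑' p : ℕ, M.powEntry p v w / M.intrinsicRadius ^ p < ∞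

/-- `M` is recurrent if it is not transient. -/
def IsRecurrent (M : Matrix V V ℝ) : Prop :=
  ¬ M.IsTransient

end Matrix

/-! Suppose `M` is transient, with finite transversal `W`. Summing Green kernels over a finite set
containing `W` gives a positive `g` with `M g ≤ λ g` everywhere and `M g ≤ λ (g - 1) ≤ λ (1 - 1/K)
g` on `W`, where `K` bounds `g` on `W`. This slack on `W` is spread over all of an `n`-element set
`F`: with a rank `r ≤ n` that vanishes on `W` and drops along arcs leaving `F \ W`, take `h = g s ^
r`. Off `W` the drop gains a factor `1/s`; on `W` at most `s ^ n` is lost, which the slack absorbs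
when `s ^ (n + 1) (1 - 1/K) = 1`. So `h` witnesses a spectral radius at most `λ / s` on `F`, hence
`λ - λ_n ≥ c / n`, which contradicts `o(1/n)`. The main steps are `exists_rank`,
`exists_superharmonic` and `exists_truncatedRadius_le`. -/

/-- A digraph without directed cycles has no closed walks of positive length. -/
theorem Digraph.not_transGen_self {α : Type*} (D : Digraph α)
    (h : ∀ (k : ℕ) (c : Fin (k + 1) → α), ¬ D.IsDirectedCycle c) (v : α) :
    ¬ Relation.TransGen D.Adj v v := by
  classical
  intro hv
  have walk : ∀ a b, Relation.TransGen D.Adj a b → ∃ (k : ℕ) (c : ℕ → α),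
      c 0 = a ∧ c (k + 1) = b ∧ ∀ i ≤ k, D.Adj (c i) (c (i + 1)) := by
    intro a b hab
    induction hab with
    | @single b hb => exact ⟨0, fun i => if i = 0 then a else b, by simp, by simp, by simpa using hb⟩
    | @tail b d _ hbd ih =>
      obtain ⟨k, c, h0, h1, hc⟩ := ih
      refine ⟨k + 1, fun i => if i ≤ k + 1 then c i else d, by simp [h0], by simp, ?_⟩
      intro i hi
      rcases hi.lt_or_eq with hi' | rfl
      · have h2 : i ≤ k := by omega
        simpa [hi, h2] using hc i h2
      · simpa [h1] using hbd
  have hex : ∃ k, ∃ c : ℕ → α, c 0 = c (k + 1) ∧ ∀ i ≤ k, D.Adj (c i) (c (i + 1)) := by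
    obtain ⟨k, c, h0, h1, hc⟩ := walk v v hv
    exact ⟨k, c, h0.trans h1.symm, hc⟩
  obtain ⟨c, hclosed, hadj⟩ := Nat.find_spec hex
  have hmin := fun m => Nat.find_min hex (m := m)
  generalize Nat.find hex = k at hclosed hadj hmin
  -- In a shortest closed walk, a repeated vertex would cut off a shorter closed walk.
  have key : ∀ i j, i < j → j ≤ k → c i ≠ c j := by
    intro i j hij hj hc
    refine hmin (j - i - 1) (by omega) ⟨fun m => c (i + m), ?_, ?_⟩
    · have : i + (j - i - 1 + 1) = j := by omega
      simpa [this] using hc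
    · intro m hm
      exact hadj (i + m) (by omega)
  refine h k (fun i => c i) ⟨?_, ?_⟩
  · intro i j hij
    by_contra hne
    rcases lt_or_gt_of_ne hne with hlt | hlt
    · exact key i j hlt (by omega) hij
    · exact key j i hlt (by omega) hij.symm
  · intro i
    have := hadj i (by omega)
    rcases eq_or_ne i (Fin.last k) with rfl | hi
    · simpa [hclosed] using this
    · have hv : ((i + 1 : Fin (k + 1)) : ℕ) = i + 1 := by simp [Fin.val_add_one, hi]
      simpa [hv] using this

/-- The vertices of a finite set that avoid a cycle transversal can be ranked so that the rank
decreases along arcs. -/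
theorem Digraph.IsCycleTransversal.exists_rank {V : Type*} {D : Digraph V} {W : Set V}
    (hW : D.IsCycleTransversal W) (F : Finset V) :
    ∃ r : V → ℕ, (∀ v, r v ≤ F.card) ∧ (∀ v ∈ W, r v = 0) ∧
      ∀ v ∈ F, v ∉ W → ∀ u, D.Adj v u → r u < r v := by
  classical
  -- Rank by the number of vertices of `F` reachable while avoiding `W`. Along an arc `v → u` it
  -- drops because `v` reaches itself, whereas `u` cannot reach `v` without closing a cycle.
  let S : {v : V // v ∉ W} → Finset V := fun v =>
    F.filter fun x => ∃ hx : x ∉ W, Relation.ReflTransGen (D.deleteVertices W).Adj v ⟨x, hx⟩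
  refine ⟨fun v => if h : v ∈ W then 0 else (S ⟨v, h⟩).card, ?_, ?_, ?_⟩
  · intro v
    dsimp only
    split_ifs
    · exact Nat.zero_le _
    · exact Finset.card_filter_le _ _
  · intro v hv
    simp [hv]
  · intro v hvF hvW u hvu
    have hself : v ∈ S ⟨v, hvW⟩ :=
      Finset.mem_filter.2 ⟨hvF, hvW, Relation.ReflTransGen.refl⟩
    by_cases huW : u ∈ W
    · simpa [huW, hvW] using ⟨v, hself⟩
    · have hadj : (D.deleteVertices W).Adj ⟨v, hvW⟩ ⟨u, huW⟩ := hvu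
      simp only [huW, hvW, dite_false]
      refine Finset.card_lt_card (Finset.ssubset_iff_of_subset ?_ |>.2 ⟨v, hself, ?_⟩)
      · intro x hx
        obtain ⟨hxF, hxW, hx⟩ := Finset.mem_filter.1 hx
        exact Finset.mem_filter.2 ⟨hxF, hxW, Relation.ReflTransGen.head hadj hx⟩
      · intro hv
        obtain ⟨-, hxW, hx⟩ := Finset.mem_filter.1 hv
        exact (D.deleteVertices W).not_transGen_self hW _ (Relation.TransGen.head' hadj hx)

namespace Matrix

/-- The easy half of the Collatz–Wielandt bound: a positive vector `h` with `B h ≤ μ h` bounds the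
spectral radius of the nonnegative matrix `B` by `μ`. -/
theorem spectralRadius_le_of_mulVec_le {ι : Type*} [Fintype ι] [DecidableEq ι]
    (B : Matrix ι ι ℝ) (hB : ∀ i j, 0 ≤ B i j) (h : ι → ℝ) (hpos : ∀ i, 0 < h i) (μ : ℝ)
    (hle : ∀ i, ∑ j, B i j * h j ≤ μ * h i) :
    spectralRadius ℂ (B.map ((↑) : ℝ → ℂ)) ≤ ENNReal.ofReal μ := by
  refine iSup₂_le fun k hk => ?_
  rw [← Matrix.spectrum_toLin', ← Module.End.hasEigenvalue_iff_mem_spectrum] at hk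
  obtain ⟨x, hx⟩ := hk.exists_hasEigenvector
  have hx0 : x ≠ 0 := hx.2
  obtain ⟨i₀, hi₀⟩ := Function.ne_iff.1 hx0
  have : Nonempty ι := ⟨i₀⟩
  -- The eigenvalue equation is evaluated where the eigenvector is largest relative to `h`.
  obtain ⟨i, hi⟩ := Finite.exists_max fun i => ‖x i‖ / h i
  have hxi : 0 < ‖x i‖ :=
    (div_pos_iff_of_pos_right (hpos i)).1
      ((div_pos (norm_pos_iff.2 hi₀) (hpos i₀)).trans_le (hi i₀))
  have heq : k * x i = ∑ j, (B i j : ℂ) * x j := by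
    have := congrFun hx.apply_eq_smul i
    simpa [Matrix.mulVec, dotProduct] using this.symm
  have hmain : ‖k‖ * ‖x i‖ ≤ μ * ‖x i‖ :=
    calc ‖k‖ * ‖x i‖ = ‖∑ j, (B i j : ℂ) * x j‖ := by rw [← heq, norm_mul]
      _ ≤ ∑ j, ‖(B i j : ℂ) * x j‖ := norm_sum_le _ _
      _ ≤ ∑ j, ‖x i‖ / h i * (B i j * h j) := by
        refine Finset.sum_le_sum fun j _ => ?_
        rw [norm_mul, Complex.norm_of_nonneg (hB i j)]
        have := mul_le_mul_of_nonneg_left ((div_le_iff₀ (hpos j)).1 (hi j)) (hB i j)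
        linarith
      _ = ‖x i‖ / h i * ∑ j, B i j * h j := by rw [Finset.mul_sum]
      _ ≤ ‖x i‖ / h i * (μ * h i) :=
        mul_le_mul_of_nonneg_left (hle i) (div_nonneg (norm_nonneg _) (hpos i).le)
      _ = μ * ‖x i‖ := by have := (hpos i).ne'; field_simp
  have := le_of_mul_le_mul_right hmain hxi
  rw [← enorm_eq_nnnorm, ← ofReal_norm]
  exact ENNReal.ofReal_le_ofReal this

variable {V : Type*}

theorem powEntry_succ' (M : Matrix V V ℝ) (p : ℕ) (v w : V) :
    M.powEntry (p + 1) v w = ∑' u, ENNReal.ofReal (M v u) * M.powEntry p u w := by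
  classical
  induction p generalizing w with
  | zero =>
    simp only [powEntry]
    rw [tsum_eq_single v (by intro u hu; simp [hu.symm]), tsum_eq_single w (by intro u hu; simp [hu])]
    simp
  | succ p ih =>
    rw [powEntry]
    simp_rw [ih]
    simp_rw [powEntry, ← ENNReal.tsum_mul_left, ← ENNReal.tsum_mul_right]
    rw [ENNReal.tsum_comm]
    simp_rw [mul_assoc]

theorem IsIrreducible.exists_powEntry_pos {M : Matrix V V ℝ} (hM : M.IsIrreducible) (v w : V) :
    ∃ p, 0 < p ∧ M.powEntry p v w ≠ 0 := by
  classical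
  let : Quiver V := M.toQuiver
  obtain ⟨q, hq⟩ := hM.connected v w
  refine ⟨q.length, hq, ?_⟩
  clear hq
  induction q with
  | nil => simp [powEntry]
  | @cons b c q e ih =>
    rw [Quiver.Path.length_cons, powEntry]
    refine fun h0 => ?_
    have := ENNReal.tsum_eq_zero.1 h0 b
    rcases mul_eq_zero.1 this with h | h
    · exact ih h
    · exact absurd (ENNReal.ofReal_eq_zero.1 h) (not_le.2 e.down)

/-- If `λ = 0`, a closed walk of positive length contributes a term `a / 0 = ∞` to the series. -/
theorem IsTransient.intrinsicRadius_ne_zero [Nonempty V] {M : Matrix V V ℝ} (hM : M.IsIrreducible)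
    (ht : M.IsTransient) : M.intrinsicRadius ≠ 0 := by
  intro h0
  obtain ⟨v⟩ := ‹Nonempty V›
  obtain ⟨p, hp, hpv⟩ := hM.exists_powEntry_pos v v
  have h1 := (ENNReal.le_tsum p).trans_lt (ht v v)
  rw [h0, zero_pow hp.ne', ENNReal.div_zero hpv] at h1
  exact lt_irrefl _ h1

/-- The Green kernel `∑ M ^ p * l ^ (-p)`. -/
noncomputable def greenKernel (M : Matrix V V ℝ) (l : ℝ≥0∞) (v w : V) : ℝ≥0∞ :=
  ∑' p : ℕ, M.powEntry p v w / l ^ p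

-- The resolvent identity `M G = l (G - 1)`, from splitting off the term `p = 0`; it is stated
-- additively to avoid truncated subtraction and to allow infinite values.
open Classical in
theorem tsum_mul_greenKernel (M : Matrix V V ℝ) {l : ℝ≥0∞} (h0 : l ≠ 0) (htop : l ≠ ∞) (v w : V) :
    (∑' u, ENNReal.ofReal (M v u) * M.greenKernel l u w) + l * (if v = w then 1 else 0) =
      l * M.greenKernel l v w := by
  have h1 : M.greenKernel l v w =
      (if v = w then 1 else 0) + ∑' p : ℕ, M.powEntry (p + 1) v w / l ^ (p + 1) := by
    rw [greenKernel, tsum_eq_zero_add' ENNReal.summable]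
    simp [powEntry]
  rw [h1, mul_add, add_comm]
  congr 1
  simp_rw [greenKernel, ← ENNReal.tsum_mul_left]
  rw [ENNReal.tsum_comm]
  refine tsum_congr fun p => ?_
  rw [powEntry_succ', div_eq_mul_inv, ← ENNReal.tsum_mul_right, ← ENNReal.tsum_mul_left]
  refine tsum_congr fun u => ?_
  rw [div_eq_mul_inv, pow_succ, ENNReal.mul_inv (Or.inr htop) (Or.inr h0)]
  calc _ = ENNReal.ofReal (M v u) * M.powEntry p u w * (l ^ p)⁻¹ * (l * l⁻¹) := by
        rw [ENNReal.mul_inv_cancel h0 htop]; ring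
    _ = _ := by ring

/-- A transient matrix has a positive superharmonic function that is strictly superharmonic, with
defect at least `λ(M)`, on a given finite set. -/
theorem IsTransient.exists_superharmonic [Nonempty V] {M : Matrix V V ℝ} (hM : M.IsIrreducible)
    (ht : M.IsTransient) (htop : M.intrinsicRadius ≠ ∞) {W : Set V} (hW : W.Finite) :
    ∃ g : V → ℝ, (∀ v, 0 < g v) ∧
      (∀ (F : Finset V) (v : V), ∑ u ∈ F, M v u * g u ≤ M.intrinsicRadius.toReal * g v) ∧
      ∀ (F : Finset V), ∀ v ∈ W, ∑ u ∈ F, M v u * g u ≤ M.intrinsicRadius.toReal * (g v - 1) := by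
  classical
  obtain ⟨w₀⟩ := ‹Nonempty V›
  have h0 := ht.intrinsicRadius_ne_zero (V := V) (M := M) (hM := hM)
  set l := M.intrinsicRadius with hl
  -- The extra vertex `w₀` keeps `G` positive even when `W` is empty.
  let T : Finset V := insert w₀ hW.toFinset
  let G : V → ℝ≥0∞ := fun v => ∑ w ∈ T, M.greenKernel l v w
  have hGtop : ∀ v, G v ≠ ∞ := fun v => ENNReal.sum_ne_top.2 fun w _ => (ht v w).ne
  have hGpos : ∀ v, G v ≠ 0 := by
    intro v hv
    have h1 := (Finset.sum_eq_zero_iff.1 hv) w₀ (Finset.mem_insert_self _ _)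
    obtain ⟨p, -, hp⟩ := hM.exists_powEntry_pos v w₀
    have h2 := ENNReal.tsum_eq_zero.1 h1 p
    rcases ENNReal.div_eq_zero_iff.1 h2 with h3 | h3
    · exact hp h3
    · exact ENNReal.pow_ne_top htop h3
  have hG : ∀ v, (∑' u, ENNReal.ofReal (M v u) * G u) + l * (if v ∈ T then 1 else 0) = l * G v := by
    intro v
    have h1 : ∑' u, ENNReal.ofReal (M v u) * G u =
        ∑ w ∈ T, ∑' u, ENNReal.ofReal (M v u) * M.greenKernel l u w := by
      rw [← Summable.tsum_finsetSum fun _ _ => ENNReal.summable]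
      simp_rw [G, Finset.mul_sum]
    have h2 : l * (if v ∈ T then 1 else 0) = ∑ w ∈ T, l * (if v = w then 1 else 0) := by
      rw [← Finset.mul_sum, Finset.sum_ite_eq]
    rw [h1, h2, ← Finset.sum_add_distrib, Finset.mul_sum]
    exact Finset.sum_congr rfl fun w _ => tsum_mul_greenKernel M h0 htop v w
  have hreal : ∀ (F : Finset V) (v : V),
      (∑ u ∈ F, M v u * (G u).toReal) + l.toReal * (if v ∈ T then 1 else 0) ≤
        l.toReal * (G v).toReal := by
    intro F v
    have h1 : (∑ u ∈ F, ENNReal.ofReal (M v u) * G u) + l * (if v ∈ T then 1 else 0) ≤ l * G v := by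
      rw [← hG v]
      gcongr
      exact ENNReal.sum_le_tsum F
    have h2 := ENNReal.toReal_mono (ENNReal.mul_ne_top htop (hGtop v)) h1
    have h3 : ∀ u ∈ F, ENNReal.ofReal (M v u) * G u ≠ ∞ := fun u _ =>
      ENNReal.mul_ne_top ENNReal.ofReal_ne_top (hGtop u)
    rw [ENNReal.toReal_add (ENNReal.sum_ne_top.2 h3)
      (ENNReal.mul_ne_top htop (by split_ifs <;> simp)), ENNReal.toReal_sum h3,
      ENNReal.toReal_mul, ENNReal.toReal_mul] at h2
    refine le_trans (le_of_eq ?_) h2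
    congr 1
    · refine Finset.sum_congr rfl fun u _ => ?_
      rw [ENNReal.toReal_mul, ENNReal.toReal_ofReal (hM.nonneg v u)]
    · split_ifs <;> simp
  refine ⟨fun v => (G v).toReal, fun v => ENNReal.toReal_pos (hGpos v) (hGtop v), ?_, ?_⟩
  · intro F v
    refine le_trans ?_ (hreal F v)
    have : 0 ≤ l.toReal * (if v ∈ T then (1 : ℝ) else 0) := by positivity
    linarith
  · intro F v hv
    have hvT : v ∈ T := Finset.mem_insert_of_mem (hW.mem_toFinset.2 hv)
    have := hreal F v
    rw [if_pos hvT] at this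
    linarith

/-- If a transient matrix has a finite cycle transversal, the truncated radii stay below `λ(M)` by
a factor `exp (-L / (n + 1))`. -/
theorem IsTransient.exists_truncatedRadius_le [Nonempty V] {M : Matrix V V ℝ}
    (hM : M.IsIrreducible) (ht : M.IsTransient) (htop : M.intrinsicRadius ≠ ∞) {W : Set V}
    (hW : W.Finite) (hcyc : M.toDigraph.IsCycleTransversal W) :
    ∃ L : ℝ, 0 < L ∧ ∀ n : ℕ, M.truncatedRadius n ≤
      ENNReal.ofReal (M.intrinsicRadius.toReal * Real.exp (-(L / (n + 1)))) := by
  classical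
  obtain ⟨g, hg, hsup, hsupW⟩ := ht.exists_superharmonic hM htop hW
  set l := M.intrinsicRadius.toReal with hl
  have hl0 : 0 ≤ l := ENNReal.toReal_nonneg
  obtain ⟨K, hK⟩ := (hW.image g).bddAbove
  -- Any bound above `1` would do; it puts `1 - K'⁻¹` strictly between `0` and `1`.
  set K' := max K 2 with hK'
  have hK2 : 2 ≤ K' := le_max_right _ _
  have hKg : ∀ v ∈ W, g v ≤ K' := fun v hv => (hK ⟨v, hv, rfl⟩).trans (le_max_left _ _)
  have hinv : K'⁻¹ ≤ 2⁻¹ := inv_anti₀ (by norm_num) hK2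
  have hinv0 : 0 < K'⁻¹ := by positivity
  have hq0 : 0 < 1 - K'⁻¹ := by norm_num at hinv ⊢; linarith
  refine ⟨-Real.log (1 - K'⁻¹), neg_pos.2 (Real.log_neg hq0 (by linarith)), fun n => ?_⟩
  set L := -Real.log (1 - K'⁻¹) with hL
  have hLpos : 0 < L := neg_pos.2 (Real.log_neg hq0 (by linarith))
  set s := Real.exp (L / (n + 1)) with hs
  have hs0 : 0 < s := Real.exp_pos _
  have hs1 : 1 ≤ s := Real.one_le_exp (by positivity)
  have hspow : s ^ (n + 1) * (1 - K'⁻¹) = 1 := by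
    have h1 : s ^ (n + 1) = Real.exp L := by
      rw [hs, ← Real.exp_nat_mul]
      congr 1
      push_cast
      field_simp
    rw [h1, hL, Real.exp_neg, Real.exp_log hq0, inv_mul_cancel₀ hq0.ne']
  refine iSup₂_le fun F hF => ?_
  obtain ⟨r, hrle, hrW, hrlt⟩ := hcyc.exists_rank F
  refine spectralRadius_le_of_mulVec_le (M.submatrix ((↑) : F → V) ((↑) : F → V))
    (fun i j => hM.nonneg _ _) (fun v => g v * s ^ r v)
    (fun v => mul_pos (hg v) (pow_pos hs0 _)) _ fun v => ?_
  rw [Real.exp_neg, ← hs]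
  simp only [submatrix_apply]
  rw [Finset.sum_coe_sort F fun u => M v u * (g u * s ^ r u)]
  have hterm : ∀ N : ℕ, (∀ u, M v u ≠ 0 → r u + 1 ≤ N) →
      s * ∑ u ∈ F, M v u * (g u * s ^ r u) ≤ s ^ N * ∑ u ∈ F, M v u * g u := by
    intro N hN
    rw [Finset.mul_sum, Finset.mul_sum]
    refine Finset.sum_le_sum fun u _ => ?_
    by_cases hu : M v u = 0
    · simp [hu]
    · have h1 : s ^ (r u + 1) ≤ s ^ N := pow_le_pow_right₀ hs1 (hN u hu)
      have h2 : 0 ≤ M v u * g u := mul_nonneg (hM.nonneg _ _) (hg u).le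
      calc _ = s ^ (r u + 1) * (M v u * g u) := by ring
        _ ≤ _ := mul_le_mul_of_nonneg_right h1 h2
  suffices h : s * ∑ u ∈ F, M v u * (g u * s ^ r u) ≤ l * (g v * s ^ r v) by
    calc _ = s⁻¹ * (s * ∑ u ∈ F, M v u * (g u * s ^ r u)) := by
          rw [← mul_assoc, inv_mul_cancel₀ hs0.ne', one_mul]
      _ ≤ s⁻¹ * (l * (g v * s ^ r v)) := mul_le_mul_of_nonneg_left h (inv_nonneg.2 hs0.le)
      _ = _ := by ring
  by_cases hv : (v : V) ∈ W
  · have hgv : g v - 1 ≤ (1 - K'⁻¹) * g v := by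
      have : K'⁻¹ * g v ≤ 1 := (inv_mul_le_one₀ (by positivity)).2 (hKg v hv)
      linarith
    calc _ ≤ s ^ (n + 1) * ∑ u ∈ F, M v u * g u :=
          hterm _ fun u _ => Nat.succ_le_succ ((hrle u).trans hF.le)
      _ ≤ s ^ (n + 1) * (l * ((1 - K'⁻¹) * g v)) :=
        mul_le_mul_of_nonneg_left
          ((hsupW F v hv).trans (mul_le_mul_of_nonneg_left hgv hl0)) (by positivity)
      _ = (s ^ (n + 1) * (1 - K'⁻¹)) * (l * g v) := by ring
      _ = l * (g v * s ^ r v) := by rw [hspow, hrW v hv]; ring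
  · calc _ ≤ s ^ r v * ∑ u ∈ F, M v u * g u := hterm _ fun u hu => hrlt v v.2 hv u hu
      _ ≤ s ^ r v * (l * g v) := mul_le_mul_of_nonneg_left (hsup F v) (by positivity)
      _ = _ := by ring

end Matrix

theorem corollary3 {V : Type*} [Infinite V] (M : Matrix V V ℝ)
    (hirr : M.IsIrreducible)
    (hfin : M.intrinsicRadius < ∞)
    (htrans : ∃ W : Set V, W.Finite ∧ M.toDigraph.IsCycleTransversal W)
    (hrate : (fun n : ℕ => M.intrinsicRadius.toReal - (M.truncatedRadius n).toReal)
      =o[atTop] (fun n : ℕ => (n : ℝ)⁻¹)) :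
    M.IsRecurrent := by
  intro ht
  obtain ⟨W, hW, hcyc⟩ := htrans
  obtain ⟨L, hL, hle⟩ := ht.exists_truncatedRadius_le hirr hfin.ne hW hcyc
  have hl : 0 < M.intrinsicRadius.toReal :=
    ENNReal.toReal_pos (ht.intrinsicRadius_ne_zero hirr) hfin.ne
  set l := M.intrinsicRadius.toReal
  -- Half the constant in the lower bound `l L / ((2 + L) n)` for the gap, which comes from `exp
  -- (-x) ≤ 1 / (1 + x)` and `n + 1 + L ≤ (2 + L) n` for `n ≥ 1`.
  have hc : 0 < l * L / (2 * (2 + L)) := by positivity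
  obtain ⟨n, hn, hn1⟩ := ((hrate.def hc).and (eventually_ge_atTop 1)).exists
  have hn1' : (1 : ℝ) ≤ n := by exact_mod_cast hn1
  have h1 : (M.truncatedRadius n).toReal ≤ l * Real.exp (-(L / (n + 1))) :=
    ENNReal.toReal_le_of_le_ofReal (by positivity) (hle n)
  have h2 : Real.exp (-(L / (n + 1))) ≤ (1 + L / (n + 1))⁻¹ := by
    rw [Real.exp_neg]
    refine inv_anti₀ (by positivity) ?_
    linarith [Real.add_one_le_exp (L / ((n : ℝ) + 1))]
  have h3 : l * L / ((2 + L) * n) ≤ l - (M.truncatedRadius n).toReal := by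
    have h4 : l * L / ((2 + L) * n) ≤ l * L / (n + 1 + L) := by
      gcongr
      nlinarith
    have h5 : l * L / (n + 1 + L) = l - l * (1 + L / (n + 1))⁻¹ := by
      field_simp
      ring
    have h6 := mul_le_mul_of_nonneg_left h2 hl.le
    linarith
  have h7 := (le_abs_self _).trans hn
  rw [Real.norm_of_nonneg (by positivity)] at h7
  have h8 : l * L / ((2 + L) * n) = 2 * (l * L / (2 * (2 + L)) * (n : ℝ)⁻¹) := by
    field_simp
  have h9 : 0 < l * L / (2 * (2 + L)) * (n : ℝ)⁻¹ := by positivity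
  linarith
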